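/- A tournament $T$ is an orientation of a finite complete graph. Inverting a set $X\subseteq V(T)$ means reversing all arcs with both endvertices in $X$. A finite digraph $D$ is strong if for every partition of $V(D)$ into two nonempty sets $V_1,V_2$ there is an arc with tail in $V_1$ and head in $V_2$; for a positive integer $k$, $D$ is $k$-strong if $|V(D)|\ge k+1$ and $D-S$ is strong for every $S\subseteq V(D)$ with $|S|<k$. Let $\mathrm{sinv}_k(T)$ be the minimum number of inversions, performed one after another, needed to transform $T$ into a $k$-strong digraph (with $\mathrm{sinv}_k(T)=+\infty$ if this is impossible). Theorem. There exists a function $f\colon\mathbb{R}_{>0}\to\mathbb{N}$ such that for every real $\epsilon>0$ and every positive integer $k$, if $T$ is a tournament on $n$ vertices with $n\ge 2k+1+\epsilon k$, then $\mathrm{sinv}_k(T)\le f(\epsilon)$. -/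

import Mathlib

namespace InversionNumber

/-- A tournament: a loopless digraph in which any two distinct vertices are joined
by exactly one arc. -/
def IsTournament {V : Type*} (D : Digraph V) : Prop :=
  (∀ u, ¬ D.Adj u u) ∧ ∀ u v, u ≠ v → (D.Adj u v ↔ ¬ D.Adj v u)

/-- The inversion of `X` in `D`: all arcs with both endvertices in `X` are reversed. -/
def invert {V : Type*} (D : Digraph V) (X : Set V) : Digraph V where
  Adj u v := (u ∈ X ∧ v ∈ X ∧ D.Adj v u) ∨ (¬ (u ∈ X ∧ v ∈ X) ∧ D.Adj u v)

/-- The digraph obtained by inverting the members of a finite family one after another. -/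
def invFamily {V : Type*} (D : Digraph V) (Xs : List (Set V)) : Digraph V :=
  Xs.foldl invert D

/-- The digraph `D - S`, induced by `D` on the vertices outside `S`. -/
def deleteVerts {V : Type*} (D : Digraph V) (S : Finset V) : Digraph {v : V // v ∉ S} where
  Adj u v := D.Adj u.1 v.1

/-- A digraph is strong if for every partition `(A, Aᶜ)` of its vertex set into two nonempty
parts there is an arc from `A` to `Aᶜ`. -/
def IsStrong {V : Type*} (D : Digraph V) : Prop :=
  ∀ A : Set V, A.Nonempty → Aᶜ.Nonempty → ∃ u ∈ A, ∃ v ∈ Aᶜ, D.Adj u v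

/-- A (finite) digraph is `k`-strong if it has at least `k + 1` vertices and stays strong after the
deletion of any set of fewer than `k` vertices. -/
def IsKStrong {V : Type*} [Fintype V] (k : ℕ) (D : Digraph V) : Prop :=
  k + 1 ≤ Fintype.card V ∧ ∀ S : Finset V, S.card < k → IsStrong (deleteVerts D S)

/-- The `k`-strong inversion number: the minimum number of inversions that transform `D` into a
`k`-strong digraph (`⊤` if there is no such family of inversions). -/
noncomputable def sinv {V : Type*} [Fintype V] (k : ℕ) (D : Digraph V) : ℕ∞ :=
  ⨅ (Xs : List (Set V)) (_ : IsKStrong k (invFamily D Xs)), (Xs.length : ℕ∞)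

end InversionNumber

namespace InversionNumber

open Finset

/-! Inversions act by adding symmetric 0/1 matrices mod 2. Giving each vertex `v` one of `s`
addresses `i v` and a free vector `h v`, 3`s` inversions realise the matrix `h u (i v) + h v (i u)`,
whatever the order `n` is. It remains to choose `h` well with `s` depending on `ε` only. For large
`n` a union bound over `h` works. Fixing one vertex, its outneighbourhood is essentially a uniform
set, so all semidegrees are about `n/2` (`card_small_degree_le`). For disjoint `A`, `B`, having no
arc from `A` to `B` determines `|B||i(A)|` bits of `h` (`card_no_arc_le`); balanced addresses make
this at least `3n`, which beats the `4^n` pairs. Semidegrees near `n/2` and arcs between all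
linear-sized sets give `k`-strength (`isKStrong_of_degree_of_expansion`), since `n ≥ (2 + ε)k`. For
bounded `n`, every vertex gets its own address, so any target tournament is reachable, in particular
one containing all arcs to the `k` cyclic successors. -/

/-- The digraph obtained from `D` by reversing the arcs between `u` and `v` whenever `M u v ≠ 0`. -/
def flip {V : Type*} (D : Digraph V) (M : V → V → ZMod 2) : Digraph V where
  Adj u v := (M u v = 0 ∧ D.Adj u v) ∨ (M u v ≠ 0 ∧ D.Adj v u)

theorem zmod_two_ne_zero_iff (x : ZMod 2) : x ≠ 0 ↔ x = 1 := by
  revert x; decide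

open Classical in
/-- The indicator of the pairs of vertices whose arc is reversed by the inversion of `X`. -/
noncomputable def pairIndicator {V : Type*} (X : Set V) (u v : V) : ZMod 2 :=
  if u ∈ X ∧ v ∈ X then 1 else 0

theorem pairIndicator_comm {V : Type*} (X : Set V) (u v : V) :
    pairIndicator X u v = pairIndicator X v u := by
  unfold pairIndicator
  by_cases hu : u ∈ X <;> by_cases hv : v ∈ X <;> simp [hu, hv]

theorem invert_flip {V : Type*} (D : Digraph V) (M : V → V → ZMod 2)
    (hM : ∀ u v, M u v = M v u) (X : Set V) :
    invert (flip D M) X = flip D (fun u v => M u v + pairIndicator X u v) := by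
  have key : ∀ x : ZMod 2, x + 1 = 0 ↔ ¬ x = 0 := by decide
  ext u v
  by_cases h : u ∈ X ∧ v ∈ X
  · simp [invert, flip, pairIndicator, h, hM v u, key]
    tauto
  · have h' : u ∈ X → v ∉ X := fun a b => h ⟨a, b⟩
    simp only [invert, flip, pairIndicator, h, if_false, add_zero]
    tauto

theorem invFamily_flip {V : Type*} (D : Digraph V) (Xs : List (Set V)) (M : V → V → ZMod 2)
    (hM : ∀ u v, M u v = M v u) :
    invFamily (flip D M) Xs =
      flip D (fun u v => M u v + (Xs.map fun X => pairIndicator X u v).sum) := by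
  induction Xs generalizing M with
  | nil => simp [invFamily]
  | cons X Xs ih =>
    have := ih (fun u v => M u v + pairIndicator X u v)
      (fun u v => by rw [hM, pairIndicator_comm])
    rw [invFamily, List.foldl_cons, invert_flip D M hM]
    rw [invFamily] at this
    rw [this]
    simp [add_assoc]

theorem flip_zero {V : Type*} (D : Digraph V) : flip D (fun _ _ => 0) = D := by
  ext u v; simp [flip]

theorem invFamily_eq_flip {V : Type*} (D : Digraph V) (Xs : List (Set V)) :
    invFamily D Xs = flip D (fun u v => (Xs.map fun X => pairIndicator X u v).sum) := by
  have := invFamily_flip D Xs (fun _ _ => 0) (fun _ _ => rfl)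
  simpa [flip_zero] using this

/-- Inverting `P`, `Q` and their symmetric difference reverses exactly the arcs `uv` with
`1_P(u) 1_Q(v) + 1_Q(u) 1_P(v) = 1`. -/
theorem pairIndicator_add_symmDiff {V : Type*} (p q : V → ZMod 2) (u v : V) :
    pairIndicator {x | p x = 1} u v + (pairIndicator {x | q x = 1} u v +
      pairIndicator {x | p x + q x = 1} u v) = p u * q v + q u * p v := by
  simp only [pairIndicator, Set.mem_ofPred_eq]
  have : ∀ a b c d : ZMod 2, ((if a = 1 ∧ b = 1 then 1 else 0 : ZMod 2) +
      ((if c = 1 ∧ d = 1 then 1 else 0) + (if a + c = 1 ∧ b + d = 1 then 1 else 0))) =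
      a * d + c * b := by decide
  convert this (p u) (p v) (q u) (q v)

/-- The pattern of reversed arcs given by an address `i v` and a function `h v` on addresses for
each vertex `v`. -/
def pattern {V : Type*} {s : ℕ} (i : V → Fin s) (h : V → Fin s → ZMod 2) (u v : V) : ZMod 2 :=
  h u (i v) + h v (i u)

/-- The pattern is a sum over addresses `a` of `p u * q v + q u * p v`, with `p` the indicator of
the fibre of `i` over `a` and `q` the column `h · a`; each summand costs three inversions. -/
theorem exists_invFamily_eq_flip_pattern {V : Type*} (D : Digraph V) {s : ℕ} (i : V → Fin s)
    (h : V → Fin s → ZMod 2) :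
    ∃ Xs : List (Set V), Xs.length = 3 * s ∧ invFamily D Xs = flip D (pattern i h) := by
  let p : Fin s → V → ZMod 2 := fun a x => if i x = a then 1 else 0
  let q : Fin s → V → ZMod 2 := fun a x => h x a
  refine ⟨(List.finRange s).flatMap fun a =>
    [{x | p a x = 1}, {x | q a x = 1}, {x | p a x + q a x = 1}], ?_, ?_⟩
  · simp [List.length_flatMap, mul_comm]
  · rw [invFamily_eq_flip]
    congr 1
    funext u v
    have : ∀ l : List (Fin s), ((l.flatMap fun a =>
        [{x | p a x = 1}, {x | q a x = 1}, {x | p a x + q a x = 1}]).map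
          fun X => pairIndicator X u v).sum = (l.map fun a => p a u * q a v + q a u * p a v).sum := by
      intro l
      induction l with
      | nil => simp
      | cons a l ih =>
        rw [List.flatMap_cons, List.map_append, List.sum_append, ih]
        simp [← pairIndicator_add_symmDiff (p a) (q a)]
    rw [this, ← List.ofFn_eq_map, List.sum_ofFn, Finset.sum_add_distrib]
    simp [p, q, pattern, add_comm]

theorem sinv_le_of_flip_pattern {V : Type*} [Fintype V] {k s : ℕ} {D : Digraph V}
    (i : V → Fin s) (h : V → Fin s → ZMod 2) (hk : IsKStrong k (flip D (pattern i h))) :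
    sinv k D ≤ ((3 * s : ℕ) : ℕ∞) := by
  obtain ⟨Xs, hl, hX⟩ := exists_invFamily_eq_flip_pattern D i h
  rw [← hl]
  exact iInf₂_le Xs (hX ▸ hk)

/-! ### Orders below a constant -/

/-- A digraph on `Fin n` in which each vertex dominates its `k` cyclic successors is `k`-strong. -/
theorem isKStrong_of_succ {n k : ℕ} [NeZero n] (hkn : k + 1 ≤ n) {V : Type*} [Fintype V]
    (e : V ≃ ZMod n) (D : Digraph V)
    (hD : ∀ u : V, ∀ j : ℕ, 1 ≤ j → j ≤ k → D.Adj u (e.symm (e u + j))) : IsKStrong k D := by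
  classical
  refine ⟨by rw [Fintype.card_congr e, ZMod.card]; exact hkn, fun S hS A hA hA' => ?_⟩
  by_contra! hno
  obtain ⟨⟨a, haS⟩, ha⟩ := hA
  obtain ⟨⟨b, hbS⟩, hb⟩ := hA'
  -- Every surviving vertex at cyclic distance `m` from a vertex of `A` is in `A`.
  have key : ∀ m : ℕ, ∀ u : {v : V // v ∉ S}, u ∈ A → ∀ w : {v : V // v ∉ S},
      e w.1 = e u.1 + m → w ∈ A := by
    intro m
    induction m using Nat.strong_induction_on with
    | _ m ih =>
      intro u hu w hw
      by_cases hm0 : m = 0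
      · have : w = u := by
          apply Subtype.ext; apply e.injective; simpa [hm0] using hw
        exact this ▸ hu
      by_cases hmk : m ≤ k
      · by_contra hwA
        apply hno u hu w hwA
        have := hD u.1 m (by omega) hmk
        rw [← hw, e.symm_apply_apply] at this
        exact this
      -- Fewer than `k` deletions cannot kill all `k` successors of `u`; a surviving one lies in `A`
      -- and is closer to `w`.
      · have : ∃ j ∈ Finset.Icc 1 k, e.symm (e u.1 + (j : ℕ)) ∉ S := by
          by_contra! hall
          have hc : (Finset.Icc 1 k).card ≤ S.card := by
            refine Finset.card_le_card_of_injOn _ hall ?_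
            intro x hx y hy hxy
            simp only [Finset.coe_Icc, Set.mem_Icc] at hx hy
            have h1 : ((x : ℕ) : ZMod n) = (y : ℕ) := add_left_cancel (e.symm.injective hxy)
            rw [ZMod.natCast_eq_natCast_iff] at h1
            exact Nat.ModEq.eq_of_lt_of_lt h1 (by omega) (by omega)
          simp at hc
          omega
        obtain ⟨j, hj, hjS⟩ := this
        rw [Finset.mem_Icc] at hj
        have hx : (⟨_, hjS⟩ : {v : V // v ∉ S}) ∈ A := by
          by_contra hxA
          exact hno u hu _ hxA (hD u.1 j hj.1 hj.2)
        refine ih (m - j) (by omega) _ hx w ?_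
        rw [hw, Equiv.apply_symm_apply, Nat.cast_sub (by omega)]
        ring
  exact hb (key (e b - e a).val ⟨a, haS⟩ ha ⟨b, hbS⟩ (by simp))

theorem sinv_le_three_mul_card {V : Type*} [Fintype V] {k : ℕ} {T : Digraph V}
    (hT : IsTournament T) (hk : 2 * k + 1 ≤ Fintype.card V) :
    sinv k T ≤ ((3 * Fintype.card V : ℕ) : ℕ∞) := by
  classical
  set n := Fintype.card V with hn
  have : NeZero n := ⟨by omega⟩
  have e : V ≃ ZMod n := Fintype.equivOfCardEq (by rw [ZMod.card])
  let i : V ≃ Fin n := Fintype.equivFin V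
  -- Only the tail of a desired arc records a reversal: as `n ≥ 2k + 1`, the two cyclic distances of
  -- a pair are never both at most `k`, so the two terms of `pattern` do not cancel.
  let h : V → Fin n → ZMod 2 := fun u a =>
    if T.Adj (i.symm a) u ∧ (e (i.symm a) - e u).val ∈ Finset.Icc 1 k then 1 else 0
  refine sinv_le_of_flip_pattern i h (isKStrong_of_succ (n := n) (by omega) e _ ?_)
  intro u j hj1 hjk
  set w := e.symm (e u + j) with hw
  have hew : e w = e u + j := by simp [hw]
  have h1 : (e w - e u).val = j := by
    rw [hew, add_sub_cancel_left, ZMod.val_natCast_of_lt (by omega)]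
  have h2 : (e u - e w).val = n - j := by
    have : e u - e w = ((n - j : ℕ) : ZMod n) := by
      rw [hew, Nat.cast_sub (by omega)]; simp
    rw [this, ZMod.val_natCast_of_lt (by omega)]
  have huw : u ≠ w := by
    intro h'
    rw [← h', sub_self, ZMod.val_zero] at h1
    omega
  have h3 : ¬ (n - j ≤ k) := by omega
  have hpat : pattern i h u w = if T.Adj w u then 1 else 0 := by
    simp [pattern, h, h1, h2, hj1, hjk, h3]
  by_cases hA : T.Adj w u
  · exact Or.inr ⟨by simp [hpat, hA], hA⟩
  · exact Or.inl ⟨by simp [hpat, hA], (hT.2 u w huw).2 hA⟩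

/-! ### Large orders -/

/-- A digraph with large semidegrees, and with an arc from `A` to `B` for all large disjoint `A`
and `B`, is `k`-strong. -/
theorem isKStrong_of_degree_of_expansion {V : Type*} [Fintype V] {k : ℕ} (D : Digraph V) (d m : ℝ)
    (hk : k + 1 ≤ Fintype.card V) (hd : m + k ≤ d)
    (hout : ∀ v, ∃ N : Finset V, d ≤ #N + 1 ∧ ∀ u ∈ N, u ≠ v ∧ D.Adj v u)
    (hin : ∀ v, ∃ N : Finset V, d ≤ #N + 1 ∧ ∀ u ∈ N, u ≠ v ∧ D.Adj u v)
    (hexp : ∀ A B : Finset V, Disjoint A B → m ≤ #A → m ≤ #B → ∃ a ∈ A, ∃ b ∈ B, D.Adj a b) :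
    IsKStrong k D := by
  classical
  refine ⟨hk, fun S hS A hA hA' => ?_⟩
  by_contra! hno
  let A₁ : Finset V := univ.filter fun v => ∃ h : v ∉ S, (⟨v, h⟩ : {v : V // v ∉ S}) ∈ A
  let B₁ : Finset V := univ.filter fun v => ∃ h : v ∉ S, (⟨v, h⟩ : {v : V // v ∉ S}) ∉ A
  have hno' : ∀ a ∈ A₁, ∀ b ∈ B₁, ¬ D.Adj a b := by
    intro a ha b hb
    obtain ⟨h1, h2⟩ := (mem_filter.1 ha).2
    obtain ⟨h3, h4⟩ := (mem_filter.1 hb).2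
    exact hno _ h2 _ h4
  have hcover : ∀ v, v ∈ S ∨ v ∈ A₁ ∨ v ∈ B₁ := by
    intro v
    by_cases hv : v ∈ S
    · exact Or.inl hv
    · by_cases hvA : (⟨v, hv⟩ : {v : V // v ∉ S}) ∈ A
      · exact Or.inr (Or.inl (mem_filter.2 ⟨mem_univ _, hv, hvA⟩))
      · exact Or.inr (Or.inr (mem_filter.2 ⟨mem_univ _, hv, hvA⟩))
  have hdisj : Disjoint A₁ B₁ := by
    rw [Finset.disjoint_left]
    intro v hv hv'
    obtain ⟨h1, h2⟩ := (mem_filter.1 hv).2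
    obtain ⟨h3, h4⟩ := (mem_filter.1 hv').2
    exact h4 h2
  -- Each side of a cut with no forward arc is large: a closed neighbourhood is trapped in that side
  -- together with `S`.
  have small : ∀ (C N : Finset V) (v : V), v ∈ C → (∀ u ∈ N, u ≠ v ∧ (u ∈ S ∨ u ∈ C)) →
      d ≤ #N + 1 → m ≤ #C := by
    intro C N v hv hN hdN
    have h1 : insert v N ⊆ S ∪ C := by
      intro u hu
      rcases mem_insert.1 hu with rfl | hu
      · exact mem_union_right _ hv
      · exact mem_union.2 (hN u hu).2
    have h2 : #N + 1 ≤ #S + #C := by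
      rw [← card_insert_of_notMem (fun h => (hN v h).1 rfl)]
      exact (card_le_card h1).trans (card_union_le _ _)
    have h3 : (#N : ℝ) + 1 ≤ #S + #C := by exact_mod_cast h2
    have h4 : (#S : ℝ) ≤ k := by exact_mod_cast hS.le
    linarith
  obtain ⟨⟨a, haS⟩, ha⟩ := hA
  obtain ⟨⟨b, hbS⟩, hb⟩ := hA'
  have ha₁ : a ∈ A₁ := mem_filter.2 ⟨mem_univ _, haS, ha⟩
  have hb₁ : b ∈ B₁ := mem_filter.2 ⟨mem_univ _, hbS, hb⟩
  have hmA : m ≤ #A₁ := by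
    obtain ⟨N, hN, hN'⟩ := hout a
    refine small A₁ N a ha₁ (fun u hu => ⟨(hN' u hu).1, ?_⟩) hN
    rcases hcover u with h | h | h
    · exact Or.inl h
    · exact Or.inr h
    · exact absurd (hN' u hu).2 (hno' a ha₁ u h)
  have hmB : m ≤ #B₁ := by
    obtain ⟨N, hN, hN'⟩ := hin b
    refine small B₁ N b hb₁ (fun u hu => ⟨(hN' u hu).1, ?_⟩) hN
    rcases hcover u with h | h | h
    · exact Or.inl h
    · exact absurd (hN' u hu).2 (hno' u h b hb₁)
    · exact Or.inr h
  obtain ⟨x, hx, y, hy, hxy⟩ := hexp A₁ B₁ hdisj hmA hmB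
  exact hno' x hx y hy hxy

/-! ### Counting bad choices of `h` -/

/-- Chernoff's bound for the number of small subsets. -/
theorem card_filter_card_le {V : Type*} [Fintype V] [DecidableEq V] (δ : ℝ) (hδ : 0 ≤ δ) :
    (#(univ.filter fun N : Finset V => (#N : ℝ) ≤ (1 / 2 - δ) * Fintype.card V) : ℝ) ≤
      2 ^ Fintype.card V * Real.exp (-(2 * δ ^ 2) * Fintype.card V) := by
  set n := Fintype.card V
  -- Exponential moment with parameter `t = 4δ`, which minimises `t²/8 - tδ` at `-2δ²`.
  set c := Real.exp (-(4 * δ)) with hc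
  have hsum : ∑ N : Finset V, c ^ #N = (1 + c) ^ n := by
    have := Finset.sum_pow_mul_eq_add_pow c 1 (univ : Finset V)
    simp only [one_pow, mul_one, powerset_univ] at this
    rw [this, add_comm, card_univ]
  have hle : (#(univ.filter fun N : Finset V => (#N : ℝ) ≤ (1 / 2 - δ) * n) : ℝ) *
      Real.exp (-(4 * δ) * ((1 / 2 - δ) * n)) ≤ (1 + c) ^ n := by
    rw [← hsum, ← nsmul_eq_mul, ← sum_const]
    refine (sum_le_sum fun N hN => ?_).trans
      (sum_le_sum_of_subset_of_nonneg (filter_subset _ _) fun N _ _ => by positivity)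
    rw [hc, ← Real.exp_nat_mul]
    apply Real.exp_le_exp.2
    nlinarith [(mem_filter.1 hN).2]
  have h1c : 1 + c ≤ 2 * Real.exp (2 * δ ^ 2 - 2 * δ) := by
    have h := Real.cosh_le_exp_half_sq (2 * δ)
    rw [Real.cosh_eq] at h
    have h2 : 1 + c = 2 * Real.exp (-(2 * δ)) *
        ((Real.exp (2 * δ) + Real.exp (-(2 * δ))) / 2) := by
      have e1 : Real.exp (-(2 * δ)) * Real.exp (2 * δ) = 1 := by rw [← Real.exp_add]; simp
      have e2 : Real.exp (-(2 * δ)) * Real.exp (-(2 * δ)) = c := by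
        rw [← Real.exp_add, hc]; ring_nf
      linear_combination -e1 - e2
    rw [h2]
    have e3 : 2 * Real.exp (2 * δ ^ 2 - 2 * δ) =
        2 * Real.exp (-(2 * δ)) * Real.exp ((2 * δ) ^ 2 / 2) := by
      rw [mul_assoc, ← Real.exp_add]; ring_nf
    rw [e3]
    gcongr
  have h3 : (1 + c) ^ n ≤ 2 ^ n * Real.exp ((2 * δ ^ 2 - 2 * δ) * n) := by
    calc (1 + c) ^ n ≤ (2 * Real.exp (2 * δ ^ 2 - 2 * δ)) ^ n := by
          gcongr
      _ = _ := by rw [mul_pow, ← Real.exp_nat_mul, mul_comm (n : ℝ)]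
  have h4 := hle.trans h3
  rw [← le_div_iff₀ (Real.exp_pos _), mul_div_assoc, ← Real.exp_sub] at h4
  refine h4.trans_eq ?_
  congr 2
  ring

/-- For a fixed vertex `v`, few functions `h` give `v` a small outdegree. -/
theorem card_small_degree_le {V : Type*} [Fintype V] [DecidableEq V] {s : ℕ} (i : V → Fin s)
    (τ : V → ZMod 2) (v : V) (d : ℝ) :
    #(univ.filter fun h : V → Fin s → ZMod 2 =>
      (#(univ.filter fun u => u ≠ v ∧ τ u + pattern i h v u = 0) : ℝ) + 1 ≤ d) ≤
    #(univ.filter fun N : Finset V => (#N : ℝ) ≤ d) * 2 ^ (Fintype.card V * (s - 1)) := by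
  -- `F` is injective: membership of `v` encodes the missing bit `h v (i v)`, and once `h v` is
  -- known, membership of `u` gives `h u (i v)`. The extra slot for `v` accounts for the `+ 1`.
  let F : (V → Fin s → ZMod 2) → Finset V × (V → {a : Fin s // a ≠ i v} → ZMod 2) := fun h =>
    (univ.filter fun u => if u = v then h v (i v) = 0 else τ u + pattern i h v u = 0,
      fun u a => h u a.1)
  have hcard : Fintype.card (V → {a : Fin s // a ≠ i v} → ZMod 2) =
      2 ^ (Fintype.card V * (s - 1)) := by
    rw [Fintype.card_fun, Fintype.card_fun, ZMod.card, ← pow_mul, mul_comm]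
    simp [Fintype.card_subtype_compl]
  rw [← hcard, ← card_univ, ← card_product]
  refine card_le_card_of_injOn F ?_ ?_
  · intro h hh
    have hh' := (mem_filter.1 (mem_coe.1 hh)).2
    refine mem_coe.2 (mem_product.2 ⟨mem_filter.2 ⟨mem_univ _, le_trans ?_ hh'⟩, mem_univ _⟩)
    have : (F h).1 ⊆ insert v (univ.filter fun u => u ≠ v ∧ τ u + pattern i h v u = 0) := by
      intro u hu
      have hu' := (mem_filter.1 hu).2
      by_cases huv : u = v
      · simp [huv]
      · rw [if_neg huv] at hu'
        simp [huv, hu']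
    have := (card_le_card this).trans (card_insert_le _ _)
    exact_mod_cast this
  · intro h _ h' _ hF
    have hF1 : (F h).1 = (F h').1 := congrArg Prod.fst hF
    have hF2 : ∀ u, ∀ a, a ≠ i v → h u a = h' u a := fun u a ha =>
      congrFun (congrFun (congrArg Prod.snd hF) u) ⟨a, ha⟩
    have z : ∀ x y : ZMod 2, (x = 0 ↔ y = 0) → x = y := by decide
    have hv : h v = h' v := by
      funext a
      by_cases ha : a = i v
      · have := Finset.ext_iff.1 hF1 v
        simp only [F, mem_filter, mem_univ, true_and, if_true] at this
        rw [ha]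
        exact z _ _ this
      · exact hF2 v a ha
    funext u a
    by_cases ha : a = i v
    · by_cases huv : u = v
      · rw [huv, hv]
      · have := Finset.ext_iff.1 hF1 u
        simp only [F, mem_filter, mem_univ, true_and, if_neg huv] at this
        have := z _ _ this
        rw [pattern, pattern, hv] at this
        rw [ha]
        exact add_left_cancel (add_left_cancel this)
    · exact hF2 u a ha

/-- For fixed disjoint `A` and `B`, few functions `h` give no arc from `A` to `B`. -/
theorem card_no_arc_le {V : Type*} [Fintype V] [DecidableEq V] {s : ℕ} (i : V → Fin s)
    (τ : V → V → ZMod 2) (A B : Finset V) (hAB : Disjoint A B) :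
    #(univ.filter fun h : V → Fin s → ZMod 2 => ∀ u ∈ A, ∀ v ∈ B, τ u v + pattern i h u v ≠ 0) *
      2 ^ (#B * #(A.image i)) ≤ 2 ^ (Fintype.card V * s) := by
  -- The entries outside `B × i(A)` determine the rest: for `u ∈ A`, `v ∈ B` the sum `h u (i v) + h
  -- v (i u)` is forced, and `u ∉ B` puts `h u (i v)` in `R`.
  let R := {p : V × Fin s // p ∉ B ×ˢ A.image i}
  have hR : Fintype.card (R → ZMod 2) * 2 ^ (#B * #(A.image i)) = 2 ^ (Fintype.card V * s) := by
    have h1 : Fintype.card R + #B * #(A.image i) = Fintype.card V * s := by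
      rw [← card_product, ← Fintype.card_coe (B ×ˢ A.image i), Fintype.card_subtype_compl,
        Nat.sub_add_cancel (Fintype.card_subtype_le _), Fintype.card_prod, Fintype.card_fin]
    rw [Fintype.card_fun, ZMod.card, ← pow_add, h1]
  rw [← hR]
  refine Nat.mul_le_mul_right _ ?_
  rw [← card_univ]
  refine card_le_card_of_injOn (fun h p => h p.1.1 p.1.2) (fun _ _ => mem_coe.2 (mem_univ _)) ?_
  intro h hh h' hh' hF
  have hh := (mem_filter.1 (mem_coe.1 hh)).2
  have hh' := (mem_filter.1 (mem_coe.1 hh')).2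
  have hF' : ∀ u a, (u, a) ∉ B ×ˢ A.image i → h u a = h' u a := fun u a hp =>
    congrFun hF ⟨(u, a), hp⟩
  funext v a
  by_cases hp : (v, a) ∈ B ×ˢ A.image i
  · obtain ⟨hv, ha⟩ := mem_product.1 hp
    obtain ⟨u, hu, rfl⟩ := mem_image.1 ha
    have e1 := hh u hu v hv
    have e2 := hh' u hu v hv
    have e3 : h u (i v) = h' u (i v) := hF' _ _ fun hc =>
      (Finset.disjoint_left.1 hAB) hu (mem_product.1 hc).1
    rw [zmod_two_ne_zero_iff] at e1 e2
    rw [← e2, pattern, pattern, e3] at e1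
    exact add_left_cancel (add_left_cancel e1)
  · exact hF' v a hp

/-- Addresses are residues mod `s` of a numbering, so every fibre has at most `⌊n/s⌋ + 1` vertices
and a large set meets many addresses. -/
theorem exists_balanced_address (V : Type*) [Fintype V] [DecidableEq V] {s : ℕ} (hs : 0 < s) :
    ∃ i : V → Fin s, ∀ A : Finset V, #A ≤ #(A.image i) * (Fintype.card V / s + 1) := by
  let e := Fintype.equivFin V
  refine ⟨fun v => ⟨e v % s, Nat.mod_lt _ hs⟩, fun A => ?_⟩
  rw [← card_range (Fintype.card V / s + 1), ← card_product]
  refine card_le_card_of_injOn (fun v => (⟨e v % s, Nat.mod_lt _ hs⟩, (e v : ℕ) / s)) ?_ ?_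
  · intro v hv
    refine mem_coe.2 (mem_product.2 ⟨mem_image_of_mem _ hv, mem_range.2 ?_⟩)
    exact Nat.lt_succ_of_le (Nat.div_le_div_right (e v).2.le)
  · intro u _ v _ huv
    simp only [Prod.mk.injEq, Fin.mk.injEq] at huv
    apply e.injective
    apply Fin.ext
    rw [← Nat.mod_add_div (e u : ℕ) s, huv.1, huv.2, Nat.mod_add_div]

open Classical in
/-- The arcs of `D` coded by the value `0`. -/
noncomputable def arcCode {V : Type*} (D : Digraph V) (u v : V) : ZMod 2 :=
  if D.Adj u v then 0 else 1

theorem flip_adj_of_arcCode {V : Type*} {T : Digraph V} (hT : IsTournament T)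
    {M : V → V → ZMod 2} {u v : V} (huv : u ≠ v) (h : arcCode T u v + M u v = 0) :
    (flip T M).Adj u v := by
  unfold arcCode at h
  split_ifs at h with hA
  · exact Or.inl ⟨by simpa using h, hA⟩
  · refine Or.inr ⟨fun h0 => by simp [h0] at h, ?_⟩
    by_contra hB
    exact hA ((hT.2 u v huv).2 hB)

theorem arcCode_add_one {V : Type*} {T : Digraph V} (hT : IsTournament T) {u v : V}
    (huv : u ≠ v) : arcCode T u v + 1 = arcCode T v u := by
  have h2 : (1 + 1 : ZMod 2) = 0 := by decide
  unfold arcCode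
  by_cases hA : T.Adj u v
  · have hB := (hT.2 u v huv).1 hA
    simp [hA, hB]
  · have hB : T.Adj v u := by
      by_contra hB
      exact hA ((hT.2 u v huv).2 hB)
    simp [hA, hB, h2]

theorem pattern_comm {V : Type*} {s : ℕ} (i : V → Fin s) (h : V → Fin s → ZMod 2) (u v : V) :
    pattern i h u v = pattern i h v u := add_comm _ _

/-- If the total number of bad choices is small, then some `h` gives large semidegrees and arcs
between all large disjoint sets. -/
theorem exists_good_pattern {V : Type*} [Fintype V] {s : ℕ} (hs : 0 < s) {δ : ℝ}
    (hδ : 0 < δ) (hsδ : 6 / δ ^ 2 ≤ s) (hsn : s ≤ Fintype.card V) {T : Digraph V}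
    (hT : IsTournament T)
    (hn : (1 / 2 : ℝ) ^ Fintype.card V +
      2 * (Fintype.card V * Real.exp (-(2 * δ ^ 2) * Fintype.card V)) < 1) :
    ∃ (i : V → Fin s) (h : V → Fin s → ZMod 2),
      (∀ v, ∃ N : Finset V, (1 / 2 - δ) * Fintype.card V ≤ #N + 1 ∧
        ∀ u ∈ N, u ≠ v ∧ (flip T (pattern i h)).Adj v u) ∧
      (∀ v, ∃ N : Finset V, (1 / 2 - δ) * Fintype.card V ≤ #N + 1 ∧
        ∀ u ∈ N, u ≠ v ∧ (flip T (pattern i h)).Adj u v) ∧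
      (∀ A B : Finset V, Disjoint A B → δ * Fintype.card V ≤ #A → δ * Fintype.card V ≤ #B →
        ∃ a ∈ A, ∃ b ∈ B, (flip T (pattern i h)).Adj a b) := by
  classical
  obtain ⟨i, hi⟩ := exists_balanced_address V hs
  refine ⟨i, ?_⟩
  set n := Fintype.card V with hn_def
  have hn0 : (0 : ℝ) < n := by exact_mod_cast hs.trans_le hsn
  have hs0 : (0 : ℝ) < s := by exact_mod_cast hs
  set d : ℝ := (1 / 2 - δ) * n with hd
  let τ := arcCode T
  let bad₁ : (V → V → ZMod 2) → V → Finset (V → Fin s → ZMod 2) := fun σ v =>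
    univ.filter fun h => (#(univ.filter fun u => u ≠ v ∧ σ v u + pattern i h v u = 0) : ℝ) + 1 ≤ d
  let P : Finset (Finset V × Finset V) := univ.filter fun p =>
    Disjoint p.1 p.2 ∧ δ * n ≤ #p.1 ∧ δ * n ≤ #p.2
  let bad₂ : Finset V × Finset V → Finset (V → Fin s → ZMod 2) := fun p =>
    univ.filter fun h => ∀ u ∈ p.1, ∀ v ∈ p.2, τ u v + pattern i h u v ≠ 0
  have hb₁ : ∀ σ v, (#(bad₁ σ v) : ℝ) ≤ 2 ^ (n * s) * Real.exp (-(2 * δ ^ 2) * n) := by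
    intro σ v
    have h1 := card_small_degree_le i (σ v) v d
    have h2 := card_filter_card_le (V := V) δ hδ.le
    have h3 : (#(bad₁ σ v) : ℝ) ≤
        #(univ.filter fun N : Finset V => (#N : ℝ) ≤ d) * 2 ^ (n * (s - 1)) := by
      rw [← Nat.cast_two (R := ℝ), ← Nat.cast_pow, ← Nat.cast_mul]
      exact Nat.cast_le.2 h1
    refine h3.trans ((mul_le_mul_of_nonneg_right h2 (by positivity)).trans_eq ?_)
    have : n * s = n + n * (s - 1) := by
      obtain ⟨t, rfl⟩ : ∃ t, s = t + 1 := ⟨s - 1, by omega⟩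
      simp; ring
    rw [this, pow_add]
    ring
  have hb₂ : ∀ p ∈ P, (#(bad₂ p) : ℝ) ≤ 2 ^ (n * s) * (1 / 8) ^ n := by
    intro p hp
    obtain ⟨hdis, hA, hB⟩ := (mem_filter.1 hp).2
    have h1 := card_no_arc_le i τ p.1 p.2 hdis
    -- As fibres have at most `2n/s` vertices, `|i(A)| ≥ δs/2`; with `|B| ≥ δn` and `δ²s ≥ 6` this
    -- gives `3n`.
    have hI : 3 * n ≤ #p.2 * #(p.1.image i) := by
      have h2 : (#p.1 : ℝ) ≤ #(p.1.image i) * ((n / s : ℕ) + 1) := by exact_mod_cast hi p.1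
      have h3 : ((n / s : ℕ) : ℝ) + 1 ≤ 2 * (n / s) := by
        have : ((n / s : ℕ) : ℝ) ≤ n / s := Nat.cast_div_le
        have : (1 : ℝ) ≤ n / s := by rw [one_le_div hs0]; exact_mod_cast hsn
        linarith
      have h4 : δ * n ≤ #(p.1.image i) * (2 * (n / s)) :=
        hA.trans (h2.trans (by gcongr))
      have h5 : δ * s ≤ 2 * #(p.1.image i) := by
        have : δ * n = δ * s * (n / s) := by field_simp
        rw [this] at h4
        have hpos : (0 : ℝ) < n / s := by positivity
        nlinarith
      have h6 : 6 ≤ δ ^ 2 * s := by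
        rw [div_le_iff₀ (by positivity)] at hsδ; linarith
      have h7 : (3 * n : ℝ) ≤ #p.2 * #(p.1.image i) := by
        calc (3 * n : ℝ) ≤ (δ ^ 2 * s / 2) * n := by gcongr; linarith
          _ = (δ * n) * (δ * s / 2) := by ring
          _ ≤ #p.2 * #(p.1.image i) := by
            gcongr
            linarith
      exact_mod_cast h7
    have h8 : #(bad₂ p) * 2 ^ (3 * n) ≤ 2 ^ (n * s) :=
      (Nat.mul_le_mul_left _ (Nat.pow_le_pow_right (by norm_num) hI)).trans h1
    have h9 : (#(bad₂ p) : ℝ) * 8 ^ n ≤ 2 ^ (n * s) := by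
      have : (#(bad₂ p) : ℝ) * 2 ^ (3 * n) ≤ 2 ^ (n * s) := by exact_mod_cast h8
      rw [pow_mul] at this
      norm_num at this
      exact this
    rw [one_div, inv_pow, ← div_eq_mul_inv, le_div_iff₀ (by positivity)]
    exact h9
  -- The code `τ + 1` describes the reversed tournament, so the last family handles indegrees.
  let bad : Finset (V → Fin s → ZMod 2) :=
    (P.biUnion bad₂) ∪ ((univ.biUnion (bad₁ τ)) ∪ (univ.biUnion (bad₁ fun u v => τ u v + 1)))
  have hu₁ : ∀ σ, (#(univ.biUnion (bad₁ σ)) : ℝ) ≤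
      n * (2 ^ (n * s) * Real.exp (-(2 * δ ^ 2) * n)) := by
    intro σ
    have h1 : (#(univ.biUnion (bad₁ σ)) : ℝ) ≤ ∑ v, (#(bad₁ σ v) : ℝ) := by
      exact_mod_cast card_biUnion_le
    refine h1.trans ((sum_le_sum fun v _ => hb₁ σ v).trans_eq ?_)
    simp [← hn_def]
  have hu₂ : (#(P.biUnion bad₂) : ℝ) ≤ 2 ^ (n * s) * (1 / 2) ^ n := by
    have h1 : (#(P.biUnion bad₂) : ℝ) ≤ ∑ p ∈ P, (#(bad₂ p) : ℝ) := by
      exact_mod_cast card_biUnion_le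
    have hP : (#P : ℝ) ≤ 4 ^ n := by
      have : #P ≤ 4 ^ n := by
        refine (card_le_univ P).trans_eq ?_
        rw [Fintype.card_prod, Fintype.card_finset, ← hn_def, ← mul_pow]
        norm_num
      exact_mod_cast this
    calc (#(P.biUnion bad₂) : ℝ) ≤ ∑ p ∈ P, (2 ^ (n * s) * (1 / 8) ^ n : ℝ) :=
          h1.trans (sum_le_sum hb₂)
      _ = #P * (2 ^ (n * s) * (1 / 8) ^ n) := by rw [sum_const, nsmul_eq_mul]
      _ ≤ 4 ^ n * (2 ^ (n * s) * (1 / 8) ^ n) := by gcongr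
      _ = 2 ^ (n * s) * (4 * (1 / 8)) ^ n := by rw [mul_pow]; ring
      _ = _ := by norm_num
  have hcard : (Fintype.card (V → Fin s → ZMod 2) : ℝ) = 2 ^ (n * s) := by
    rw [Fintype.card_fun, Fintype.card_fun, ZMod.card, Fintype.card_fin, ← pow_mul,
      mul_comm s, ← hn_def]
    push_cast
    rfl
  have hlt : (#bad : ℝ) < Fintype.card (V → Fin s → ZMod 2) := by
    have h1 : (#bad : ℝ) ≤ #(P.biUnion bad₂) + (#(univ.biUnion (bad₁ τ)) +
        #(univ.biUnion (bad₁ fun u v => τ u v + 1))) := by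
      exact_mod_cast (card_union_le _ _).trans (Nat.add_le_add_left (card_union_le _ _) _)
    rw [hcard]
    have h2 : (0 : ℝ) < 2 ^ (n * s) := by positivity
    have h3 := mul_lt_mul_of_pos_left hn h2
    have h4 := hu₁ τ
    have h5 := hu₁ fun u v => τ u v + 1
    nlinarith
  obtain ⟨h, hh⟩ : ∃ h, h ∉ bad := by
    by_contra! hall
    have : bad = univ := eq_univ_of_forall hall
    rw [this, card_univ] at hlt
    exact lt_irrefl _ hlt
  simp only [bad, mem_union, not_or, mem_biUnion, not_exists, not_and, mem_univ,
    true_implies] at hh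
  obtain ⟨hh₂, hh₁, hh₁'⟩ := hh
  refine ⟨h, fun v => ?_, fun v => ?_, fun A B hdis hA hB => ?_⟩
  · have := hh₁ v
    simp only [bad₁, mem_filter, mem_univ, true_and, not_le] at this
    refine ⟨_, this.le, fun u hu => ?_⟩
    obtain ⟨huv, h0⟩ := (mem_filter.1 hu).2
    exact ⟨huv, flip_adj_of_arcCode hT huv.symm h0⟩
  · have := hh₁' v
    simp only [bad₁, mem_filter, mem_univ, true_and, not_le] at this
    refine ⟨_, this.le, fun u hu => ?_⟩
    obtain ⟨huv, h0⟩ := (mem_filter.1 hu).2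
    rw [arcCode_add_one hT huv.symm, pattern_comm] at h0
    exact ⟨huv, flip_adj_of_arcCode hT huv h0⟩
  · have := hh₂ (A, B) (mem_filter.2 ⟨mem_univ _, hdis, hA, hB⟩)
    simp only [bad₂, mem_filter, mem_univ, true_and] at this
    push Not at this
    obtain ⟨u, hu, v, hv, h0⟩ := this
    exact ⟨u, hu, v, hv, flip_adj_of_arcCode hT
      (fun huv => Finset.disjoint_left.1 hdis hu (huv ▸ hv)) h0⟩

/-! ### Choice of constants -/

theorem exists_threshold {δ : ℝ} (hδ : 0 < δ) : ∃ N : ℕ, ∀ n ≥ N,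
    (1 / 2 : ℝ) ^ n + 2 * (n * Real.exp (-(2 * δ ^ 2) * n)) < 1 := by
  have h1 : Filter.Tendsto (fun n : ℕ => (1 / 2 : ℝ) ^ n) Filter.atTop (nhds 0) :=
    tendsto_pow_atTop_nhds_zero_of_lt_one (by norm_num) (by norm_num)
  have h2 : Filter.Tendsto (fun n : ℕ => (n : ℝ) * Real.exp (-(2 * δ ^ 2)) ^ n)
      Filter.atTop (nhds 0) :=
    tendsto_self_mul_const_pow_of_lt_one (Real.exp_pos _).le
      (Real.exp_lt_one_iff.mpr (by have := pow_pos hδ 2; linarith))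
  have h3 := h1.add (h2.const_mul 2)
  rw [mul_zero, add_zero] at h3
  obtain ⟨N, hN⟩ := Filter.eventually_atTop.1 (h3.eventually (gt_mem_nhds one_pos))
  refine ⟨N, fun n hn => ?_⟩
  have := hN n hn
  rwa [← Real.exp_nat_mul, mul_comm (n : ℝ) (-(2 * δ ^ 2))] at this

theorem exists_sinv_bound {ε : ℝ} (hε : 0 < ε) : ∃ c : ℕ, ∀ k : ℕ,
    ∀ (V : Type*) [Fintype V] (T : Digraph V), IsTournament T →
      2 * (k : ℝ) + 1 + ε * k ≤ (Fintype.card V : ℝ) → sinv k T ≤ (c : ℕ∞) := by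
  -- Chosen so that `1/2 - 2δ = 1/(2 + ε)`; then `n ≥ (2 + ε)k` yields `δn + k ≤ (1/2 - δ)n`.
  set δ : ℝ := ε / (4 * (2 + ε)) with hδ_def
  have hδ : 0 < δ := by positivity
  obtain ⟨N, hN⟩ := exists_threshold hδ
  set s : ℕ := ⌈6 / δ ^ 2⌉₊ with hs_def
  have hs : 0 < s := Nat.ceil_pos.2 (by positivity)
  refine ⟨3 * max s N, fun k V _ T hT hV => ?_⟩
  have hk0 : (0 : ℝ) ≤ k := by positivity
  have hkn : 2 * k + 1 ≤ Fintype.card V := by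
    have : (2 * k + 1 : ℝ) ≤ Fintype.card V := by nlinarith
    exact_mod_cast this
  rcases le_total (Fintype.card V) (max s N) with hsmall | hlarge
  · refine (sinv_le_three_mul_card hT hkn).trans ?_
    exact_mod_cast Nat.mul_le_mul_left 3 hsmall
  · obtain ⟨i, h, hout, hin, hexp⟩ := exists_good_pattern hs hδ (Nat.le_ceil _)
      ((le_max_left _ _).trans hlarge) hT (hN _ ((le_max_right _ _).trans hlarge))
    refine (sinv_le_of_flip_pattern i h (isKStrong_of_degree_of_expansion _ _ _ (by omega) ?_
      hout hin hexp)).trans (by exact_mod_cast Nat.mul_le_mul_left 3 (le_max_left _ _))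
    have h1 : (1 / 2 - 2 * δ) * (2 + ε) = 1 := by rw [hδ_def]; field_simp; ring
    have h2 : 0 ≤ 1 / 2 - 2 * δ := by
      by_contra! hc
      nlinarith
    have h3 : (k : ℝ) ≤ (1 / 2 - 2 * δ) * Fintype.card V := by
      calc (k : ℝ) = (1 / 2 - 2 * δ) * ((2 + ε) * k) := by rw [← mul_assoc, h1, one_mul]
        _ ≤ _ := by gcongr; linarith
    linarith

end InversionNumber

theorem mainTheorem10 :
    ∃ f : Set.Ioi (0 : ℝ) → ℕ, ∀ (ε : Set.Ioi (0 : ℝ)) (k : ℕ), 0 < k →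
      ∀ (V : Type*) [Fintype V] (T : Digraph V), InversionNumber.IsTournament T →
        2 * (k : ℝ) + 1 + (ε : ℝ) * k ≤ (Fintype.card V : ℝ) →
          InversionNumber.sinv k T ≤ (f ε : ℕ∞) := by
  choose c hc using fun ε : Set.Ioi (0 : ℝ) => InversionNumber.exists_sinv_bound ε.2
  exact ⟨c, fun ε k _ V _ T hT hV => hc ε k V T hT hV⟩
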